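/- Let $d\ge 1$. For each $j=1,\dots,d$ let $p_j,q_j$ be positive, continuously differentiable functions on $(0,1)$ such that $p_j/q_j$ is strictly increasing, and suppose that there are a continuously differentiable function $u_j$ and a continuous function $v_j$ on $(0,1)$ such that $f=p_j$ and $f=q_j$ both satisfy $\frac{d}{dx}\bigl(u_j(x)f'(x)\bigr)+v_j(x)f(x)=0$ for all $x\in(0,1)$. Let $$k(\mathbf x,\mathbf x')=\prod_{j=1}^d p_j(\min(x_j,x_j'))\,q_j(\max(x_j,x_j')),\qquad \mathbf x,\mathbf x'\in(0,1)^d,$$ be the associated tensor Markov kernel, and let $\{Y(\mathbf x):\mathbf x\in(0,1)^d\}$ be a zero mean Gaussian process with covariance function $k$. Suppose that $Y$ is observed without noise at distinct design points $\mathbf x_1,\dots,\mathbf x_n$ that form the full dyadic lattice $\{i\,2^{-\tau}:1\le i\le 2^\tau-1\}^d$ for some integer $\tau\ge1$ (so $n=(2^\tau-1)^d$), and let $$\widehat Y_n(\mathbf x)=\mathbf k(\mathbf x)^{\top}\mathbf K^{-1}\mathbf y,\qquad \mathbf k(\mathbf x)=(k(\mathbf x,\mathbf x_i))_{i\le n},\quad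 \mathbf K=(k(\mathbf x_i,\mathbf x_j))_{i,j\le n},\quad \mathbf y=(Y(\mathbf x_i))_{i\le n},$$ be the kriging predictor. Then there is a constant $c>0$, independent of $n$, such that for all sufficiently large $n$ of this form $$\sup_{\mathbf x\in(0,1)^d}\mathbb E\bigl[(\widehat Y_n(\mathbf x)-Y(\mathbf x))^2\bigr]\ \ge\ c\,n^{-1/d},$$ where the supremum is taken in $[0,\infty]$. -/

import Mathlib

open MeasureTheory ProbabilityTheory Matrix Set Filter
open scoped ENNReal

/-- The open unit cube `(0,1)^d`, the design space. -/
def openCube (d : ℕ) : Set (Fin d → ℝ) := Set.univ.pi fun _ => Set.Ioo (0 : ℝ) 1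

/-- `p` and `q` generate a one-dimensional Gauss-Markov kernel on the set `I`: both are positive
on `I` and `p / q` is strictly increasing on `I`. -/
structure IsMarkovPair (I : Set ℝ) (p q : ℝ → ℝ) : Prop where
  pos_left : ∀ x ∈ I, 0 < p x
  pos_right : ∀ x ∈ I, 0 < q x
  strictMonoOn_div : StrictMonoOn (fun x => p x / q x) I

/-- The tensor Markov kernel `∏ j, p_j (x_j ∧ x'_j) * q_j (x_j ∨ x'_j)` on the open unit cube. -/
def tmKernel {d : ℕ} (p q : Fin d → ℝ → ℝ) (x x' : openCube d) : ℝ :=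
  ∏ j, p j (min (x.1 j) (x'.1 j)) * q j (max (x.1 j) (x'.1 j))

/-- `f` solves the Sturm-Liouville equation `(u f')' + v f = 0` on `(0,1)`; in particular
`u f'` is differentiable there. -/
def SolvesSturmLiouville (u v f : ℝ → ℝ) : Prop :=
  ∀ x ∈ Set.Ioo (0 : ℝ) 1, HasDerivAt (fun t => u t * deriv f t) (-(v x * f x)) x

/-- The regularity condition on one coordinate of the kernel: `p` and `q` are continuously
differentiable on `(0,1)` and both solve one and the same equation `(u f')' + v f = 0`, with `u`
continuously differentiable and `v` continuous. -/
structure SturmLiouvilleRegular (p q : ℝ → ℝ) : Prop where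
  contDiffOn_left : ContDiffOn ℝ 1 p (Set.Ioo 0 1)
  contDiffOn_right : ContDiffOn ℝ 1 q (Set.Ioo 0 1)
  exists_equation : ∃ u v : ℝ → ℝ, ContDiffOn ℝ 1 u (Set.Ioo 0 1) ∧
    ContinuousOn v (Set.Ioo 0 1) ∧ SolvesSturmLiouville u v p ∧ SolvesSturmLiouville u v q

/-- `Y` is a zero mean Gaussian process with covariance function `k` under `P`. -/
structure IsCenteredGP {T Ω : Type*} [MeasurableSpace Ω] (k : T → T → ℝ) (Y : T → Ω → ℝ)
    (P : Measure Ω) : Prop where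
  isGaussianProcess : IsGaussianProcess Y P
  mean_eq_zero : ∀ x, ∫ ω, Y x ω ∂P = 0
  covariance_eq : ∀ x x', cov[Y x, Y x'; P] = k x x'

/-- The kernel matrix `(k (x_i, x_j))_{i,j}` of the design `X = (x_1, …, x_n)`. -/
def kernelMatrix {T : Type*} {n : ℕ} (k : T → T → ℝ) (X : Fin n → T) :
    Matrix (Fin n) (Fin n) ℝ :=
  Matrix.of fun i j => k (X i) (X j)

/-- The noise-free kriging predictor `k(x)ᵀ K⁻¹ y`, where `k(x) = (k (x, x_i))_i` and
`y = (Y (x_i))_i`. -/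
noncomputable def krigingPredictor {T Ω : Type*} {n : ℕ} (k : T → T → ℝ) (Y : T → Ω → ℝ)
    (X : Fin n → T) (x : T) (ω : Ω) : ℝ :=
  (fun i => k x (X i)) ⬝ᵥ ((kernelMatrix k X)⁻¹ *ᵥ fun i => Y (X i) ω)

/-- The mean squared error of the kriging predictor at `x`, as an element of `[0, ∞]`. -/
noncomputable def krigingMSE {T Ω : Type*} [MeasurableSpace Ω] {n : ℕ} (k : T → T → ℝ)
    (Y : T → Ω → ℝ) (P : Measure Ω) (X : Fin n → T) (x : T) : ℝ≥0∞ :=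
  ∫⁻ ω, ENNReal.ofReal ((krigingPredictor k Y X x ω - Y x ω) ^ 2) ∂P

/-- The dyadic grid `{i * 2^(-τ) : 1 ≤ i ≤ 2^τ - 1}`. -/
def dyadicGrid (τ : ℕ) : Set ℝ := {x | ∃ i : ℕ, 1 ≤ i ∧ i ≤ 2 ^ τ - 1 ∧ x = (i : ℝ) / 2 ^ τ}

/-- The full dyadic lattice of level `τ`: the `d`-fold Cartesian power of `dyadicGrid τ`. -/
def fullGrid (d τ : ℕ) : Set (Fin d → ℝ) := Set.univ.pi fun _ => dyadicGrid τ

/-!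
If `k(x, ·)` agrees on the design with a linear combination of the functions `k(x_i, ·)`, then the
same combination of the observations is, by orthogonality, at least as good as every linear
predictor, kriging included, and its error variance is a lower bound for the kriging error.

With `F = p / q`, the one-dimensional kernel is `q x * q y * F (min x y)`: Brownian motion run at
clock `F` and rescaled by `q`. So on a line parallel to a coordinate axis through lattice points, a
point `x` between neighbours `s` and `t` is optimally predicted from these two alone. If
`F x` is the midpoint of `F s` and `F t`, then the error variance is `q x ^ 2 * (F t - F s) / 4`,
up to the factor contributed by the fixed coordinates. The increments of `F` over the lattice cells
of `[1/4, 3/4]` add up to `F (3/4) - F (1/4) > 0`, so one of the cells, each of length `2 ^ (-τ)`,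
has an increment of order at least `2 ^ (-τ)`, which is the order of `n ^ (-1/d)`.
-/

section LinearPrediction

variable {T Ω : Type*} {n : ℕ}

/-- The linear predictor with weights `w` formed from the observations of `Y` at the design `X`. -/
def linearPredictor (Y : T → Ω → ℝ) (X : Fin n → T) (w : Fin n → ℝ) : Ω → ℝ :=
  ∑ i, w i • Y (X i)

theorem krigingPredictor_eq_linearPredictor (k : T → T → ℝ) (Y : T → Ω → ℝ) (X : Fin n → T)
    (x : T) : krigingPredictor k Y X x =
      linearPredictor Y X ((fun i => k x (X i)) ᵥ* (kernelMatrix k X)⁻¹) := by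
  ext ω
  rw [krigingPredictor, dotProduct_mulVec]
  simp only [linearPredictor, Finset.sum_apply, Pi.smul_apply, smul_eq_mul, dotProduct]

variable [MeasurableSpace Ω] {P : Measure Ω} {k : T → T → ℝ} {Y : T → Ω → ℝ}

/-- `Y` is a square-integrable process with covariance function `k` under `P`; its mean function
is arbitrary. -/
structure IsSecondOrderProcess (k : T → T → ℝ) (Y : T → Ω → ℝ) (P : Measure Ω) : Prop where
  memLp_two : ∀ t, MemLp (Y t) 2 P
  covariance_eq : ∀ s t, cov[Y s, Y t; P] = k s t

theorem IsCenteredGP.isSecondOrderProcess (hY : IsCenteredGP k Y P) :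
    IsSecondOrderProcess k Y P where
  memLp_two t := (hY.isGaussianProcess.hasGaussianLaw_eval t).memLp_two
  covariance_eq := hY.covariance_eq

theorem variance_sub_le_variance_sub_of_covariance_eq_zero [IsFiniteMeasure P] {U V W : Ω → ℝ}
    (hU : MemLp U 2 P) (hV : MemLp V 2 P) (hW : MemLp W 2 P) (h : cov[U - V, V - W; P] = 0) :
    Var[U - V; P] ≤ Var[U - W; P] := by
  rw [← sub_add_sub_cancel U V W, variance_add (hU.sub hV) (hV.sub hW), h]
  linarith [variance_nonneg (V - W) P]

namespace IsSecondOrderProcess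

theorem memLp_linearPredictor (hY : IsSecondOrderProcess k Y P) (X : Fin n → T) (w : Fin n → ℝ) :
    MemLp (linearPredictor Y X w) 2 P :=
  memLp_finsetSum' _ fun _ _ => (hY.memLp_two _).const_smul _

theorem ofReal_variance_sub_krigingPredictor_le_krigingMSE [IsProbabilityMeasure P]
    (hY : IsSecondOrderProcess k Y P) (X : Fin n → T) (x : T) :
    ENNReal.ofReal Var[Y x - krigingPredictor k Y X x; P] ≤ krigingMSE k Y P X x := by
  have hL : MemLp (Y x - krigingPredictor k Y X x) 2 P := by
    rw [krigingPredictor_eq_linearPredictor]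
    exact (hY.memLp_two x).sub (hY.memLp_linearPredictor X _)
  calc ENNReal.ofReal Var[Y x - krigingPredictor k Y X x; P]
      ≤ ENNReal.ofReal (∫ ω, (Y x - krigingPredictor k Y X x) ω ^ 2 ∂P) :=
        ENNReal.ofReal_le_ofReal (variance_le_expectation_sq hL.aestronglyMeasurable)
    _ = krigingMSE k Y P X x := by
        rw [ofReal_integral_eq_lintegral_ofReal hL.integrable_sq
          (Eventually.of_forall fun _ => sq_nonneg _), krigingMSE]
        simp only [Pi.sub_apply, sub_sq_comm]

theorem covariance_linearPredictor_left [IsFiniteMeasure P] (hY : IsSecondOrderProcess k Y P)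
    (X : Fin n → T) (w : Fin n → ℝ) (t : T) :
    cov[linearPredictor Y X w, Y t; P] = w ⬝ᵥ fun i => k (X i) t := by
  simp only [linearPredictor, dotProduct, covariance_smul_left, hY.covariance_eq,
    covariance_sum_left (fun i => (hY.memLp_two (X i)).const_smul (w i)) (hY.memLp_two t)]

theorem covariance_sub_linearPredictor [IsFiniteMeasure P] (hY : IsSecondOrderProcess k Y P)
    (X : Fin n → T) (x : T) (w : Fin n → ℝ) (t : T) :
    cov[Y x - linearPredictor Y X w, Y t; P] = k x t - w ⬝ᵥ fun i => k (X i) t := by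
  rw [covariance_sub_left (hY.memLp_two x) (hY.memLp_linearPredictor X w) (hY.memLp_two t),
    hY.covariance_eq, hY.covariance_linearPredictor_left]

variable {X : Fin n → T} {x : T} {w : Fin n → ℝ}

theorem covariance_sub_linearPredictor_linearPredictor [IsFiniteMeasure P]
    (hY : IsSecondOrderProcess k Y P)
    (hw : ∀ i, k x (X i) = w ⬝ᵥ fun l => k (X l) (X i)) (a : Fin n → ℝ) :
    cov[Y x - linearPredictor Y X w, linearPredictor Y X a; P] = 0 := by
  rw [linearPredictor.eq_def Y X a, covariance_sum_right
    (fun i => (hY.memLp_two (X i)).const_smul (a i))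
    ((hY.memLp_two x).sub (hY.memLp_linearPredictor X w))]
  simp only [covariance_smul_right, hY.covariance_sub_linearPredictor, hw, sub_self, mul_zero,
    Finset.sum_const_zero]

theorem variance_sub_linearPredictor [IsFiniteMeasure P] (hY : IsSecondOrderProcess k Y P)
    (hw : ∀ i, k x (X i) = w ⬝ᵥ fun l => k (X l) (X i)) :
    Var[Y x - linearPredictor Y X w; P] = k x x - w ⬝ᵥ fun l => k (X l) x := by
  have hR : MemLp (Y x - linearPredictor Y X w) 2 P :=
    (hY.memLp_two x).sub (hY.memLp_linearPredictor X w)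
  rw [← covariance_self hR.aemeasurable,
    covariance_sub_right hR (hY.memLp_two x) (hY.memLp_linearPredictor X w),
    hY.covariance_sub_linearPredictor_linearPredictor hw, sub_zero,
    hY.covariance_sub_linearPredictor]

theorem variance_sub_linearPredictor_le [IsFiniteMeasure P] (hY : IsSecondOrderProcess k Y P)
    (hw : ∀ i, k x (X i) = w ⬝ᵥ fun l => k (X l) (X i)) (a : Fin n → ℝ) :
    Var[Y x - linearPredictor Y X w; P] ≤ Var[Y x - linearPredictor Y X a; P] := by
  have hL := hY.memLp_linearPredictor X
  refine variance_sub_le_variance_sub_of_covariance_eq_zero (hY.memLp_two x) (hL w) (hL a) ?_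
  rw [covariance_sub_right ((hY.memLp_two x).sub (hL w)) (hL w) (hL a),
    hY.covariance_sub_linearPredictor_linearPredictor hw,
    hY.covariance_sub_linearPredictor_linearPredictor hw, sub_zero]

theorem ofReal_sub_dotProduct_le_krigingMSE [IsProbabilityMeasure P]
    (hY : IsSecondOrderProcess k Y P)
    (hw : ∀ i, k x (X i) = w ⬝ᵥ fun l => k (X l) (X i)) :
    ENNReal.ofReal (k x x - w ⬝ᵥ fun l => k (X l) x) ≤ krigingMSE k Y P X x := by
  refine le_trans (ENNReal.ofReal_le_ofReal ?_)
    (hY.ofReal_variance_sub_krigingPredictor_le_krigingMSE X x)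
  rw [← hY.variance_sub_linearPredictor hw, krigingPredictor_eq_linearPredictor]
  exact hY.variance_sub_linearPredictor_le hw _

end IsSecondOrderProcess

end LinearPrediction

section MarkovKernel

variable {p q : ℝ → ℝ} {s x t y : ℝ}

/-- The one-dimensional Gauss-Markov kernel `p (x ∧ y) * q (x ∨ y)`, the factor of `tmKernel`
belonging to a single coordinate. -/
def markovKernel (p q : ℝ → ℝ) (x y : ℝ) : ℝ := p (min x y) * q (max x y)

theorem markovKernel_self (p q : ℝ → ℝ) (x : ℝ) : markovKernel p q x x = p x * q x := by
  rw [markovKernel, min_self, max_self]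

theorem markovKernel_eq_mul_div_min (hx : q x ≠ 0) (hy : q y ≠ 0) :
    markovKernel p q x y = q x * q y * (p (min x y) / q (min x y)) := by
  rcases le_total x y with h | h
  · rw [markovKernel, min_eq_left h, max_eq_right h]
    field_simp
  · rw [markovKernel, min_eq_right h, max_eq_left h]
    field_simp

theorem markovKernel_eq_of_div_eq_midpoint (hsx : s ≤ x) (hxt : x ≤ t) (hqs : q s ≠ 0)
    (hqx : q x ≠ 0) (hqt : q t ≠ 0) (hqy : q y ≠ 0)
    (hmid : p x / q x = (p s / q s + p t / q t) / 2) (hy : y ∉ Ioo s t) :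
    markovKernel p q x y =
      q x / (2 * q s) * markovKernel p q s y + q x / (2 * q t) * markovKernel p q t y := by
  have hmin : p (min x y) / q (min x y) =
      (p (min s y) / q (min s y) + p (min t y) / q (min t y)) / 2 := by
    rcases le_or_gt y s with hys | hsy
    · rw [min_eq_right hys, min_eq_right (hys.trans hsx), min_eq_right (hys.trans (hsx.trans hxt)),
        add_self_div_two]
    · have hty : t ≤ y := not_lt.1 fun hyt => hy ⟨hsy, hyt⟩
      rw [min_eq_left hsy.le, min_eq_left (hxt.trans hty), min_eq_left hty, hmid]
  rw [markovKernel_eq_mul_div_min hqx hqy, markovKernel_eq_mul_div_min hqs hqy,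
    markovKernel_eq_mul_div_min hqt hqy, hmin]
  field_simp

theorem markovKernel_residual_of_div_eq_midpoint (hsx : s ≤ x) (hxt : x ≤ t) (hqs : q s ≠ 0)
    (hqx : q x ≠ 0) (hqt : q t ≠ 0) (hmid : p x / q x = (p s / q s + p t / q t) / 2) :
    markovKernel p q x x -
        (q x / (2 * q s) * markovKernel p q s x + q x / (2 * q t) * markovKernel p q t x) =
      q x ^ 2 * (p t / q t - p s / q s) / 4 := by
  rw [markovKernel_eq_mul_div_min hqx hqx, markovKernel_eq_mul_div_min hqs hqx,
    markovKernel_eq_mul_div_min hqt hqx, min_self, min_eq_left hsx, min_eq_right hxt, hmid]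
  field_simp
  ring

end MarkovKernel

section TensorKernel

variable {d : ℕ} {p q : Fin d → ℝ → ℝ} {j : Fin d}

/-- The point obtained from `c` by replacing its `j`-th coordinate by `y`; as `y` varies, it runs
through the line in the cube through `c` parallel to the `j`-th axis. -/
def replaceCoord (c : openCube d) (j : Fin d) (y : Ioo (0 : ℝ) 1) : openCube d :=
  ⟨Function.update c.1 j y, (update_mem_pi_iff_of_mem c.2).2 fun _ => y.2⟩

theorem tmKernel_replaceCoord (p q : Fin d → ℝ → ℝ) (c : openCube d) (j : Fin d)
    (y : Ioo (0 : ℝ) 1) (z : openCube d) :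
    tmKernel p q (replaceCoord c j y) z = markovKernel (p j) (q j) y (z.1 j) *
      ∏ l ∈ Finset.univ.erase j, markovKernel (p l) (q l) (c.1 l) (z.1 l) := by
  rw [tmKernel, ← Finset.mul_prod_erase _ _ (Finset.mem_univ j)]
  congr 1
  · simp only [replaceCoord, Function.update_self, markovKernel]
  · refine Finset.prod_congr rfl fun l hl => ?_
    simp only [replaceCoord, Function.update_of_ne (Finset.ne_of_mem_erase hl), markovKernel]

theorem tmKernel_replaceCoord_replaceCoord (p q : Fin d → ℝ → ℝ) (c : openCube d) (j : Fin d)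
    (y y' : Ioo (0 : ℝ) 1) :
    tmKernel p q (replaceCoord c j y) (replaceCoord c j y') = markovKernel (p j) (q j) y y' *
      ∏ l ∈ Finset.univ.erase j, p l (c.1 l) * q l (c.1 l) := by
  rw [tmKernel_replaceCoord]
  congr 1
  · simp only [replaceCoord, Function.update_self]
  · refine Finset.prod_congr rfl fun l hl => ?_
    simp only [replaceCoord, Function.update_of_ne (Finset.ne_of_mem_erase hl), markovKernel_self]

theorem ofReal_le_krigingMSE_replaceCoord {Ω : Type*} [MeasurableSpace Ω] {P : Measure Ω}
    [IsProbabilityMeasure P] {Y : openCube d → Ω → ℝ}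
    (hY : IsSecondOrderProcess (tmKernel p q) Y P) (hq : ∀ y ∈ Ioo (0 : ℝ) 1, q j y ≠ 0)
    {n : ℕ} {X : Fin n → openCube d} {c : openCube d} {s x t : Ioo (0 : ℝ) 1}
    (hsx : s ≤ x) (hxt : x ≤ t)
    (hmid : p j x / q j x = (p j s / q j s + p j t / q j t) / 2)
    (hs : replaceCoord c j s ∈ range X) (ht : replaceCoord c j t ∈ range X)
    (hX : ∀ i, (X i).1 j ∉ Ioo (s : ℝ) t) :
    ENNReal.ofReal (q j x ^ 2 * (p j t / q j t - p j s / q j s) / 4 *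
        ∏ l ∈ Finset.univ.erase j, p l (c.1 l) * q l (c.1 l)) ≤
      krigingMSE (tmKernel p q) Y P X (replaceCoord c j x) := by
  obtain ⟨a, ha⟩ := hs
  obtain ⟨b, hb⟩ := ht
  have hqs := hq s s.2
  have hqx := hq x x.2
  have hqt := hq t t.2
  set w : Fin n → ℝ := Pi.single a (q j x / (2 * q j s)) + Pi.single b (q j x / (2 * q j t))
  have hw (f : Fin n → ℝ) : w ⬝ᵥ f = q j x / (2 * q j s) * f a + q j x / (2 * q j t) * f b := by
    rw [add_dotProduct, single_dotProduct, single_dotProduct]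
  have hinterp (i : Fin n) : tmKernel p q (replaceCoord c j x) (X i) =
      w ⬝ᵥ fun l => tmKernel p q (X l) (X i) := by
    simp only [hw, ha, hb, tmKernel_replaceCoord, ← mul_assoc, ← add_mul]
    rw [markovKernel_eq_of_div_eq_midpoint hsx hxt hqs hqx hqt (hq _ ((X i).2 j (mem_univ j)))
      hmid (hX i)]
  refine le_of_eq_of_le (congrArg ENNReal.ofReal ?_)
    (hY.ofReal_sub_dotProduct_le_krigingMSE hinterp)
  simp only [hw, ha, hb, tmKernel_replaceCoord_replaceCoord, ← mul_assoc, ← add_mul, ← sub_mul]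
  rw [markovKernel_residual_of_div_eq_midpoint hsx hxt hqs hqx hqt hmid]

end TensorKernel

section DyadicGrid

variable {d τ n : ℕ}

theorem natCast_div_mem_dyadicGrid {i : ℕ} (hi : 1 ≤ i) (hiτ : i < 2 ^ τ) :
    (i : ℝ) / 2 ^ τ ∈ dyadicGrid τ :=
  ⟨i, hi, Nat.le_sub_one_of_lt hiτ, rfl⟩

theorem half_mem_dyadicGrid (hτ : 1 ≤ τ) : (1 / 2 : ℝ) ∈ dyadicGrid τ := by
  obtain ⟨k, rfl⟩ := Nat.exists_eq_add_of_le' hτ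
  have hhalf : (1 / 2 : ℝ) = ((2 ^ k : ℕ) : ℝ) / 2 ^ (k + 1) := by
    push_cast
    field_simp
    ring
  rw [hhalf]
  exact natCast_div_mem_dyadicGrid Nat.one_le_two_pow
    (Nat.pow_lt_pow_right one_lt_two k.lt_succ_self)

theorem disjoint_dyadicGrid_Ioo (τ i : ℕ) :
    Disjoint (dyadicGrid τ) (Ioo ((i : ℝ) / 2 ^ τ) (((i + 1 : ℕ) : ℝ) / 2 ^ τ)) := by
  rw [Set.disjoint_left]
  rintro _ ⟨l, -, -, rfl⟩ ⟨hil, hli⟩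
  rw [div_lt_div_iff_of_pos_right (by positivity), Nat.cast_lt] at hil hli
  omega

theorem ncard_dyadicGrid (τ : ℕ) : (dyadicGrid τ).ncard = 2 ^ τ - 1 := by
  have himage : dyadicGrid τ =
      (fun i : ℕ => (i : ℝ) / 2 ^ τ) '' (Finset.Icc 1 (2 ^ τ - 1) : Finset ℕ) := by
    ext x
    simp only [dyadicGrid, mem_ofPred_eq, mem_image, Finset.coe_Icc, mem_Icc, and_assoc, eq_comm]
  have hinj : Function.Injective fun i : ℕ => (i : ℝ) / 2 ^ τ :=
    fun a b hab =>
    Nat.cast_injective ((div_left_inj' (by positivity)).1 hab)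
  rw [himage, ncard_image_of_injective _ hinj, ncard_coe_finset, Nat.card_Icc, Nat.add_sub_cancel]

theorem ncard_fullGrid (d τ : ℕ) : (fullGrid d τ).ncard = (2 ^ τ - 1) ^ d := by
  rw [fullGrid, ← Nat.card_coe_set_eq,
    Nat.card_congr (Equiv.Set.univPi fun _ : Fin d => dyadicGrid τ), Nat.card_pi]
  simp only [Nat.card_coe_set_eq, ncard_dyadicGrid, Finset.prod_const, Finset.card_univ,
    Fintype.card_fin]

theorem eq_pow_of_range_eq_fullGrid {X : Fin n → openCube d} (hX : Function.Injective X)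
    (hrange : range (fun i => (X i : Fin d → ℝ)) = fullGrid d τ) : n = (2 ^ τ - 1) ^ d := by
  rw [← ncard_fullGrid, ← hrange, ← Nat.card_coe_set_eq,
    ← Function.comp_def Subtype.val X,
    Nat.card_range_of_injective (Subtype.val_injective.comp hX), Nat.card_fin]

theorem replaceCoord_mem_range {X : Fin n → openCube d}
    (hrange : range (fun i => (X i : Fin d → ℝ)) = fullGrid d τ) {c : openCube d}
    (hc : c.1 ∈ fullGrid d τ) (j : Fin d) {y : Ioo (0 : ℝ) 1} (hy : (y : ℝ) ∈ dyadicGrid τ) :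
    replaceCoord c j y ∈ range X := by
  have hmem : (replaceCoord c j y).1 ∈ fullGrid d τ :=
    (update_mem_pi_iff_of_mem hc).2 fun _ => hy
  rw [← hrange] at hmem
  obtain ⟨i, hi⟩ := hmem
  exact ⟨i, Subtype.ext hi⟩

theorem rpow_neg_one_div_le_two_div (hd : d ≠ 0) (hτ : 1 ≤ τ) :
    (((2 ^ τ - 1) ^ d : ℕ) : ℝ) ^ (-(1 / (d : ℝ))) ≤ 2 / 2 ^ τ := by
  have htwo : (2 : ℝ) ≤ 2 ^ τ := le_self_pow₀ one_le_two (by omega)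
  have hcast : ((2 ^ τ - 1 : ℕ) : ℝ) = 2 ^ τ - 1 := by
    rw [Nat.cast_sub Nat.one_le_two_pow]
    push_cast
    rfl
  rw [Nat.cast_pow, Real.rpow_neg (by positivity), one_div,
    Real.pow_rpow_inv_natCast (Nat.cast_nonneg _) hd, hcast, inv_eq_one_div,
    div_le_div_iff₀ (by linarith) (by linarith)]
  linarith

theorem exists_mem_Ico_div_le_sub {K : Type*} [Field K] [LinearOrder K] [IsStrictOrderedRing K]
    (f : ℕ → K) {a b : ℕ} (hab : a < b) :
    ∃ i ∈ Finset.Ico a b, (f b - f a) / ((b : K) - a) ≤ f (i + 1) - f i := by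
  have hlen : (b : K) - a ≠ 0 := sub_ne_zero.2 (Nat.cast_injective.ne hab.ne')
  refine Finset.exists_le_of_sum_le (Finset.nonempty_Ico.2 hab) ?_
  rw [Finset.sum_Ico_sub f hab.le, Finset.sum_const, Nat.card_Ico, nsmul_eq_mul,
    Nat.cast_sub hab.le, mul_div_cancel₀ _ hlen]

theorem exists_dyadicGrid_gap_div_le_sub (hτ : 2 ≤ τ) (F : ℝ → ℝ) :
    ∃ s ∈ dyadicGrid τ, ∃ t ∈ dyadicGrid τ, 1 / 4 ≤ s ∧ s ≤ t ∧ t ≤ 3 / 4 ∧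
      Disjoint (dyadicGrid τ) (Ioo s t) ∧ 2 * (F (3 / 4) - F (1 / 4)) / 2 ^ τ ≤ F t - F s := by
  obtain ⟨k, rfl⟩ := Nat.exists_eq_add_of_le' hτ
  have hk : 0 < 2 ^ k := by positivity
  have hpow : 2 ^ (k + 2) = 4 * 2 ^ k := by ring
  have hpowR : (2 : ℝ) ^ (k + 2) = 4 * 2 ^ k := by ring
  obtain ⟨i, hi, hinc⟩ := exists_mem_Ico_div_le_sub (fun i : ℕ => F ((i : ℝ) / 2 ^ (k + 2)))
    (a := 2 ^ k) (b := 3 * 2 ^ k) (by omega)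
  obtain ⟨hki, hik⟩ := Finset.mem_Ico.1 hi
  have hquarter : ((2 ^ k : ℕ) : ℝ) / 2 ^ (k + 2) = 1 / 4 := by
    push_cast
    rw [hpowR]
    field_simp
  have hthree : ((3 * 2 ^ k : ℕ) : ℝ) / 2 ^ (k + 2) = 3 / 4 := by
    push_cast
    rw [hpowR]
    field_simp
  refine ⟨_, natCast_div_mem_dyadicGrid (i := i) (by omega) (by omega),
    _, natCast_div_mem_dyadicGrid (i := i + 1) (by omega) (by omega), ?_, ?_, ?_,
    disjoint_dyadicGrid_Ioo _ i, le_of_eq_of_le ?_ hinc⟩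
  · rw [← hquarter]
    gcongr
  · gcongr
    omega
  · rw [← hthree]
    gcongr
    omega
  · simp only [hquarter, hthree]
    push_cast
    rw [hpowR]
    field_simp
    ring

theorem two_le_of_two_le_two_pow_sub_one_pow (h : 2 ≤ (2 ^ τ - 1) ^ d) : 2 ≤ τ := by
  by_contra! hτ
  have hbase : 2 ^ τ - 1 ≤ 1 := by interval_cases τ <;> simp
  exact absurd (h.trans (pow_le_one' hbase d)) (by norm_num)

end DyadicGrid

theorem exists_mem_Icc_eq_midpoint {F : ℝ → ℝ} {s t : ℝ} (hst : s ≤ t)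
    (hF : ContinuousOn F (Icc s t)) : ∃ x ∈ Icc s t, F x = (F s + F t) / 2 := by
  have hmid : (F s + F t) / 2 ∈ uIcc (F s) (F t) := by
    rcases le_total (F s) (F t) with h | h
    · exact mem_uIcc_of_le (by linarith) (by linarith)
    · exact mem_uIcc_of_ge (by linarith) (by linarith)
  rw [← uIcc_of_le hst] at hF ⊢
  exact intermediate_value_uIcc hF hmid

theorem ofReal_le_iSup_krigingMSE_of_range_eq_fullGrid {d : ℕ} {p q : Fin d → ℝ → ℝ} {j : Fin d}
    {Ω : Type*} [MeasurableSpace Ω] {P : Measure Ω} [IsProbabilityMeasure P]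
    {Y : openCube d → Ω → ℝ} (hY : IsSecondOrderProcess (tmKernel p q) Y P)
    (hp : ContinuousOn (p j) (Ioo 0 1)) (hq : ContinuousOn (q j) (Ioo 0 1))
    (hq0 : ∀ y ∈ Ioo (0 : ℝ) 1, q j y ≠ 0) {c : openCube d}
    (hc : 0 ≤ ∏ l ∈ Finset.univ.erase j, p l (c.1 l) * q l (c.1 l))
    {m : ℝ} (hm : 0 ≤ m) (hmq : ∀ y ∈ Icc (1 / 4 : ℝ) (3 / 4), m ≤ q j y)
    (hF : p j (1 / 4) / q j (1 / 4) ≤ p j (3 / 4) / q j (3 / 4))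
    {n τ : ℕ} (hτ : 2 ≤ τ) {X : Fin n → openCube d} (hcτ : c.1 ∈ fullGrid d τ)
    (hrange : range (fun i => (X i : Fin d → ℝ)) = fullGrid d τ) :
    ENNReal.ofReal (m ^ 2 *
        (2 * (p j (3 / 4) / q j (3 / 4) - p j (1 / 4) / q j (1 / 4)) / 2 ^ τ) / 4 *
        ∏ l ∈ Finset.univ.erase j, p l (c.1 l) * q l (c.1 l)) ≤
      ⨆ x : openCube d, krigingMSE (tmKernel p q) Y P X x := by
  obtain ⟨s, hs, t, ht, hs4, hst, ht4, hdisj, hinc⟩ :=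
    exists_dyadicGrid_gap_div_le_sub hτ fun y => p j y / q j y
  have hsub : Icc s t ⊆ Ioo 0 1 := Icc_subset_Ioo (by linarith) (by linarith)
  obtain ⟨x, hx, hmid⟩ := exists_mem_Icc_eq_midpoint hst ((hp.div hq hq0).mono hsub)
  have hgap (i : Fin n) : (X i).1 j ∉ Ioo s t := by
    have hXi : (X i).1 ∈ fullGrid d τ := hrange ▸ mem_range_self i
    exact disjoint_left.1 hdisj (hXi j (mem_univ j))
  have hres := ofReal_le_krigingMSE_replaceCoord hY hq0 (s := ⟨s, hsub (left_mem_Icc.2 hst)⟩)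
    (x := ⟨x, hsub hx⟩) (t := ⟨t, hsub (right_mem_Icc.2 hst)⟩) hx.1 hx.2 hmid
    (replaceCoord_mem_range hrange hcτ j hs) (replaceCoord_mem_range hrange hcτ j ht) hgap
  refine le_trans (ENNReal.ofReal_le_ofReal ?_) (hres.trans (le_iSup _ _))
  have hqx : m ^ 2 ≤ q j x ^ 2 :=
    pow_le_pow_left₀ hm (hmq x ⟨hs4.trans hx.1, hx.2.trans ht4⟩) 2
  exact mul_le_mul_of_nonneg_right (div_le_div_of_nonneg_right (mul_le_mul hqx hinc
    (div_nonneg (mul_nonneg zero_le_two (sub_nonneg.2 hF)) (by positivity)) (sq_nonneg _))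
    zero_le_four) hc

theorem proposition2_general {d : ℕ} (p q : Fin d → ℝ → ℝ)
    (hpq : ∀ j, IsMarkovPair (Ioo 0 1) (p j) (q j)) (j : Fin d)
    (hp : ContinuousOn (p j) (Ioo 0 1)) (hq : ContinuousOn (q j) (Ioo 0 1))
    {Ω : Type*} [MeasurableSpace Ω] (P : Measure Ω) [IsProbabilityMeasure P]
    (Y : openCube d → Ω → ℝ) (hY : IsSecondOrderProcess (tmKernel p q) Y P) :
    ∃ c : ℝ, 0 < c ∧ ∀ᶠ n : ℕ in atTop, ∀ τ : ℕ, ∀ X : Fin n → openCube d,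
      Function.Injective X → range (fun i => (X i : Fin d → ℝ)) = fullGrid d τ →
      ENNReal.ofReal (c * (n : ℝ) ^ (-(1 / (d : ℝ)))) ≤
        ⨆ x : openCube d, krigingMSE (tmKernel p q) Y P X x := by
  have hhalf : (1 / 2 : ℝ) ∈ Ioo (0 : ℝ) 1 := by norm_num
  obtain ⟨m, hm, hmq⟩ := isCompact_Icc.exists_forall_le'
    (hq.mono (Icc_subset_Ioo (by norm_num) (by norm_num) : Icc (1 / 4 : ℝ) (3 / 4) ⊆ Ioo 0 1))
    fun y hy => (hpq j).pos_right y ⟨by linarith [hy.1], by linarith [hy.2]⟩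
  set L : ℝ := p j (3 / 4) / q j (3 / 4) - p j (1 / 4) / q j (1 / 4)
  have hL : 0 < L := sub_pos.2 <| (hpq j).strictMonoOn_div (by norm_num) (by norm_num) (by norm_num)
  set C : ℝ := ∏ l ∈ Finset.univ.erase j, p l (1 / 2) * q l (1 / 2)
  have hC : 0 < C := Finset.prod_pos fun l _ =>
    mul_pos ((hpq l).pos_left _ hhalf) ((hpq l).pos_right _ hhalf)
  refine ⟨m ^ 2 * L * C / 4, by positivity, ?_⟩
  filter_upwards [eventually_ge_atTop 2] with n hn τ X hX hrange
  obtain rfl := eq_pow_of_range_eq_fullGrid hX hrange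
  have hτ : 2 ≤ τ := two_le_of_two_le_two_pow_sub_one_pow hn
  refine le_trans (ENNReal.ofReal_le_ofReal ?_) (ofReal_le_iSup_krigingMSE_of_range_eq_fullGrid
    (c := ⟨fun _ => 1 / 2, fun _ _ => hhalf⟩) hY hp hq (fun y hy => ((hpq j).pos_right y hy).ne')
    hC.le hm.le hmq (sub_pos.1 hL).le hτ (fun _ _ => half_mem_dyadicGrid (by omega)) hrange)
  calc m ^ 2 * L * C / 4 * (((2 ^ τ - 1) ^ d : ℕ) : ℝ) ^ (-(1 / (d : ℝ)))
      ≤ m ^ 2 * L * C / 4 * (2 / 2 ^ τ) := by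
        gcongr
        exact rpow_neg_one_div_le_two_div j.pos.ne' (by omega)
    _ = m ^ 2 * (2 * L / 2 ^ τ) / 4 * C := by ring

theorem proposition2 {d : ℕ} (hd : 1 ≤ d) (p q : Fin d → ℝ → ℝ)
    (hpq : ∀ j, IsMarkovPair (Set.Ioo 0 1) (p j) (q j))
    (hSL : ∀ j, SturmLiouvilleRegular (p j) (q j))
    {Ω : Type*} [MeasurableSpace Ω] (P : Measure Ω) [IsProbabilityMeasure P]
    (Y : openCube d → Ω → ℝ) (hY : IsCenteredGP (tmKernel p q) Y P) :
    ∃ c : ℝ, 0 < c ∧ ∀ᶠ n : ℕ in atTop, ∀ τ : ℕ, 1 ≤ τ → ∀ X : Fin n → openCube d,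
      Function.Injective X → Set.range (fun i => (X i : Fin d → ℝ)) = fullGrid d τ →
      ENNReal.ofReal (c * (n : ℝ) ^ (-(1 / (d : ℝ)))) ≤
        ⨆ x : openCube d, krigingMSE (tmKernel p q) Y P X x := by
  obtain ⟨c, hc, h⟩ := proposition2_general p q hpq ⟨0, hd⟩ (hSL _).contDiffOn_left.continuousOn
    (hSL _).contDiffOn_right.continuousOn P Y hY.isSecondOrderProcess
  exact ⟨c, hc, h.mono fun _ hn τ _ => hn τ⟩
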